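/- Let $K$ be a finite-dimensional abstract simplicial complex with vertex set $V$, and let $L$ be a flag complex, i.e. a simplicial complex in which every nonempty finite set of vertices that pairwise span edges is a simplex. For a simplicial complex $M$ let $|M|$ be its geometric complex: the space of functions $x$ from the vertices of $M$ to $[0,1]$ whose support is a simplex and whose values sum to $1$, with the metric $d(x,y)=\bigl(\sum_v (x(v)-y(v))^2\bigr)^{1/2}$; a simplicial map $\phi: M\to N$ induces the continuous map $|\phi|:|M|\to|N|$, $|\phi|(x)(w)=\sum_{\phi(v)=w}x(v)$. For a simplex $\sigma$ of $K$ let $b(\sigma)\in|K|$ be its barycenter, and let $\mathrm{sd}(K)$ be the barycentric subdivision of $K$: its vertices are the barycenters $b(\sigma)$ of the simplices of $K$, and its simplices are the nonempty finite sets $\{b(\sigma_0),\dots,b(\sigma_k)\}$ with $\sigma_0\subset\dots\subset\sigma_k$. Let $f: K\to L$ and $g:\mathrm{sd}(K)\to L$ be simplicial maps such that (a) $g(b(\{v\}))=f(v)$ for every vertex $v$ of $K$; (b) $f(\sigma)\cup\{g(b(\sigma))\}$ is a simplex of $L$ for every simplex $\sigma$ of $K$. Then the linear map $h:|\mathrm{sd}(K)|\to|K|$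 sending each vertex of $\mathrm{sd}(K)$ to the corresponding point of $|K|$, that is $h(x)=\sum_\sigma x(b(\sigma))\,b(\sigma)$, is a homeomorphism, and $|g|$ is homotopic to $|f|\circ h$; equivalently, $|g|\circ h^{-1}$ is homotopic to $|f|$. -/

import Mathlib

namespace AbstractSimplicialComplex

/-- `L` is a flag complex: every nonempty finite set of vertices, any two of which span an edge,
is a simplex. -/
def IsFlag {W : Type*} [DecidableEq W] (L : AbstractSimplicialComplex W) : Prop :=
  ∀ s : Finset W, s.Nonempty → (∀ u ∈ s, ∀ v ∈ s, u ≠ v → ({u, v} : Finset W) ∈ L) → s ∈ L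

/-- `K` is finite-dimensional: for some `k` every simplex of `K` has at most `k + 1` vertices. -/
def IsFiniteDimensional {V : Type*} (K : AbstractSimplicialComplex V) : Prop :=
  ∃ k : ℕ, ∀ σ ∈ K, σ.card ≤ k + 1

/-- A simplicial map `K → L`: a map of vertices that sends simplices to simplices. -/
structure SimplicialMap {V W : Type*} [DecidableEq W]
    (K : AbstractSimplicialComplex V) (L : AbstractSimplicialComplex W) where
  /-- the underlying map of vertices -/
  toFun : V → W
  image_mem : ∀ σ ∈ K, σ.image toFun ∈ L

/-- The barycentric subdivision. Its vertices are the simplices `σ` of `K` (`σ` standing for its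
barycenter), its simplices are the nonempty finite sets of simplices of `K` that are totally
ordered by inclusion. -/
def sd {V : Type*} (K : AbstractSimplicialComplex V) :
    AbstractSimplicialComplex {σ : Finset V // σ ∈ K} where
  faces := {s | s.Nonempty ∧ IsChain (fun σ τ : {σ : Finset V // σ ∈ K} => σ.1 ⊆ τ.1)
    (s : Set {σ : Finset V // σ ∈ K})}
  isRelLowerSet_faces := fun {_} hs =>
    ⟨hs.1, fun {_} hts ht => ⟨ht, fun _ ha _ hb hne => hs.2 (hts ha) (hts hb) hne⟩⟩
  singleton_mem := fun v => ⟨Finset.singleton_nonempty v, by simp⟩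

/-- The geometric complex `|K|`: all functions `x : V → [0, 1]` whose support is a simplex of `K`
and whose values sum to `1`. The support being finite, the functions are taken as
finitely supported ones; the bound `x v ≤ 1` is automatic. -/
@[ext]
structure Realization {V : Type*} (K : AbstractSimplicialComplex V) where
  /-- the barycentric coordinates -/
  coord : V →₀ ℝ
  support_mem : coord.support ∈ K
  nonneg : ∀ v, 0 ≤ coord v
  sum_eq_one : (coord.sum fun _ a => a) = 1

section Norms

variable {V W : Type*}

/-- The Euclidean norm of a finitely supported function. -/
noncomputable def l2 (z : V →₀ ℝ) : ℝ := √(z.sum fun _ a => a ^ 2)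

lemma l2_eq {z : V →₀ ℝ} {s : Finset V} (h : z.support ⊆ s) :
    l2 z = ‖WithLp.toLp 2 (fun i : s => z i)‖ := by
  rw [l2, EuclideanSpace.norm_eq, Finsupp.sum_of_support_subset z h _ (by simp)]
  congr 1
  simp only [Real.norm_eq_abs, sq_abs]
  exact (Finset.sum_coe_sort s (fun i => z i ^ 2)).symm

lemma l2_add_le (y z : V →₀ ℝ) : l2 (y + z) ≤ l2 y + l2 z := by
  classical
  rw [l2_eq (Finsupp.support_add : (y + z).support ⊆ y.support ∪ z.support),
    l2_eq (s := y.support ∪ z.support) Finset.subset_union_left,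
    l2_eq (s := y.support ∪ z.support) Finset.subset_union_right]
  exact norm_add_le (WithLp.toLp 2 fun i : (y.support ∪ z.support : Finset V) => y i)
    (WithLp.toLp 2 fun i : (y.support ∪ z.support : Finset V) => z i)

lemma l2_neg (z : V →₀ ℝ) : l2 (-z) = l2 z := by
  simp [l2, Finsupp.sum]

lemma abs_le_l2 (z : V →₀ ℝ) (v : V) : |z v| ≤ l2 z := by
  by_cases hv : v ∈ z.support
  · refine Real.abs_le_sqrt ?_
    exact Finset.single_le_sum (f := fun v => z v ^ 2) (fun _ _ => sq_nonneg _) hv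
  · rw [Finsupp.notMem_support_iff.mp hv, abs_zero]
    exact Real.sqrt_nonneg _

lemma l2_le_l1 (z : V →₀ ℝ) : l2 z ≤ z.sum fun _ a => |a| := by
  refine Real.sqrt_le_iff.mpr ⟨Finset.sum_nonneg fun _ _ => abs_nonneg _, ?_⟩
  have h := Finset.sum_sq_le_sq_sum_of_nonneg (s := z.support) (f := fun v => |z v|)
    (fun _ _ => abs_nonneg _)
  simpa only [sq_abs, Finsupp.sum] using h

lemma l1_mapDomain_le (φ : V → W) (z : V →₀ ℝ) :
    ((z.mapDomain φ).sum fun _ a => |a|) ≤ z.sum fun _ a => |a| := by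
  classical
  have key : ∀ y z : W →₀ ℝ, ((y + z).sum fun _ a => |a|) ≤
      (y.sum fun _ a => |a|) + z.sum fun _ a => |a| := by
    intro y z
    rw [Finsupp.sum_of_support_subset _ Finsupp.support_add _ (by simp),
      Finsupp.sum_of_support_subset y (Finset.subset_union_left (s₂ := z.support)) _ (by simp),
      Finsupp.sum_of_support_subset z (Finset.subset_union_right (s₁ := y.support)) _ (by simp),
      ← Finset.sum_add_distrib]
    exact Finset.sum_le_sum fun _ _ => abs_add_le _ _
  induction z using Finsupp.induction with
  | zero => simp
  | single_add a b z ha hb ih =>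
    rw [Finsupp.mapDomain_add, Finsupp.mapDomain_single,
      Finsupp.sum_add_index_of_disjoint (f1 := Finsupp.single a b)]
    · refine (key _ _).trans ?_
      rw [Finsupp.sum_single_index (by simp), Finsupp.sum_single_index (by simp)]
      linarith
    · rw [Finsupp.support_single a hb]
      simpa using ha

end Norms

/-- The standard metric on `|K|`: the Euclidean distance
`d(x, y) = (∑ v, (x v - y v) ^ 2) ^ (1 / 2)` of barycentric coordinates. -/
noncomputable instance {V : Type*} (K : AbstractSimplicialComplex V) :
    MetricSpace K.Realization where
  dist x y := √((x.coord - y.coord).sum fun _ a => a ^ 2)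
  dist_self x := by simp
  dist_comm x y := by
    change l2 _ = l2 _
    rw [← l2_neg, neg_sub]
  dist_triangle x y z := by
    change l2 _ ≤ l2 _ + l2 _
    have h := l2_add_le (x.coord - y.coord) (y.coord - z.1)
    rwa [sub_add_sub_cancel] at h
  eq_of_dist_eq_zero := by
    intro x y h
    change l2 _ = 0 at h
    refine Realization.ext (Finsupp.ext fun v => ?_)
    have := abs_le_l2 (x.coord - y.coord) v
    rw [h] at this
    simpa [sub_eq_zero] using this

lemma l1_sub_le {V : Type*} {K : AbstractSimplicialComplex V} (x y : K.Realization) :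
    ((y.coord - x.coord).sum fun _ a => |a|) ≤ 2 * x.coord.support.card * dist y x := by
  classical
  have hd : ∀ v, |y.coord v - x.coord v| ≤ dist y x := fun v => abs_le_l2 (y.coord - x.coord) v
  set S := x.coord.support with hS
  have hsub : (y.coord - x.coord).support ⊆ S ∪ (y.coord.support \ S) := by
    rw [Finset.union_sdiff_self_eq_union, Finset.union_comm]
    exact Finsupp.support_sub
  have hSd : ∑ v ∈ S, |y.coord v - x.coord v| ≤ S.card * dist y x := by
    simpa using Finset.sum_le_card_nsmul S _ _ (fun v _ => hd v)
  have hx1 : ∑ v ∈ S, x.coord v = 1 := x.sum_eq_one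
  have hy1 : ∑ v ∈ S, y.coord v + ∑ v ∈ y.coord.support \ S, y.coord v = 1 := by
    rw [← Finset.sum_union Finset.disjoint_sdiff, ← y.sum_eq_one,
      Finsupp.sum_of_support_subset y.coord (s := S ∪ y.coord.support \ S) _ _ (by simp)]
    rw [Finset.union_sdiff_self_eq_union]
    exact Finset.subset_union_right
  have hout : ∑ v ∈ y.coord.support \ S, |y.coord v - x.coord v| = ∑ v ∈ y.coord.support \ S, y.coord v := by
    refine Finset.sum_congr rfl fun v hv => ?_
    have : x.coord v = 0 := Finsupp.notMem_support_iff.mp (Finset.mem_sdiff.mp hv).2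
    rw [this, sub_zero, abs_of_nonneg (y.nonneg v)]
  have hdiff : ∑ v ∈ S, x.coord v - ∑ v ∈ S, y.coord v ≤ ∑ v ∈ S, |y.coord v - x.coord v| := by
    rw [← Finset.sum_sub_distrib]
    exact Finset.sum_le_sum fun v _ => by rw [abs_sub_comm]; exact le_abs_self _
  rw [Finsupp.sum_of_support_subset _ hsub _ (by simp), Finset.sum_union Finset.disjoint_sdiff]
  simp only [Finsupp.sub_apply]
  rw [hout]
  linarith

/-- The continuous map `|φ| : |K| → |L|` induced by a simplicial map `φ`: the coordinate of
`|φ|(x)` at a vertex `w` is the sum of `x v` over the `v` with `φ v = w`. -/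
noncomputable def SimplicialMap.realization {V W : Type*} [DecidableEq W]
    {K : AbstractSimplicialComplex V} {L : AbstractSimplicialComplex W} (φ : SimplicialMap K L) :
    C(K.Realization, L.Realization) where
  toFun x :=
    have h0 : ∀ w, 0 ≤ x.coord.mapDomain φ.toFun w := by
      intro w
      rw [Finsupp.mapDomain, Finsupp.sum_apply, Finsupp.sum]
      refine Finset.sum_nonneg fun v _ => ?_
      rw [Finsupp.single_apply]
      split_ifs
      exacts [x.nonneg v, le_rfl]
    have h1 : ((x.coord.mapDomain φ.toFun).sum fun _ a => a) = 1 := by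
      rw [Finsupp.sum_mapDomain_index (by simp) (by simp)]
      exact x.sum_eq_one
    { coord := x.coord.mapDomain φ.toFun
      support_mem := by
        refine (L.isRelLowerSet_faces (φ.image_mem _ x.support_mem)).2
          Finsupp.mapDomain_support ?_
        rw [Finset.nonempty_iff_ne_empty]
        intro h
        rw [Finsupp.sum, h] at h1
        simp at h1
      nonneg := h0
      sum_eq_one := h1 }
  continuous_toFun := by
    rw [Metric.continuous_iff]
    intro x ε hε
    refine ⟨ε / (2 * x.coord.support.card + 1), by positivity, fun y hy => ?_⟩
    change l2 (y.coord.mapDomain φ.toFun - x.coord.mapDomain φ.toFun) < ε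
    have hm : y.coord.mapDomain φ.toFun - x.coord.mapDomain φ.toFun =
        (y.coord - x.coord).mapDomain φ.toFun :=
      (map_sub (Finsupp.mapDomain.addMonoidHom φ.toFun) y.coord x.coord).symm
    rw [hm]
    have h := ((l2_le_l1 _).trans (l1_mapDomain_le φ.toFun (y.coord - x.coord))).trans (l1_sub_le x y)
    rw [lt_div_iff₀ (by positivity)] at hy
    have : 0 ≤ dist y x := dist_nonneg
    nlinarith

/-- The barycenter `b(σ) ∈ |K|` of a simplex `σ`: all its coordinates at the vertices of `σ` are
`1 / |σ|`, the others are `0`. -/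
noncomputable def barycenter {V : Type*} (K : AbstractSimplicialComplex V)
    (σ : {σ : Finset V // σ ∈ K}) : K.Realization :=
  have hne : σ.1.Nonempty := (K.isRelLowerSet_faces σ.2).1
  have hc : (σ.1.card : ℝ) ≠ 0 := by exact_mod_cast hne.card_ne_zero
  have hs : (Finsupp.indicator σ.1 fun _ _ => (1 / σ.1.card : ℝ)).support = σ.1 := by
    classical
    ext v
    rw [Finsupp.mem_support_iff, Finsupp.indicator_apply]
    split_ifs with h
    · simp [h, hne.ne_empty]
    · simp [h]
  { coord := Finsupp.indicator σ.1 fun _ _ => (1 / σ.1.card : ℝ)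
    support_mem := by rw [hs]; exact σ.2
    nonneg := by
      intro v
      classical
      rw [Finsupp.indicator_apply]
      split_ifs
      exacts [by positivity, le_rfl]
    sum_eq_one := by
      classical
      rw [Finsupp.sum, hs, Finset.sum_congr rfl
        (fun v hv => Finsupp.indicator_of_mem hv (fun _ _ => (1 / σ.1.card : ℝ)))]
      simp [hc] }

/-- The linear map `h : |sd K| → |K|` sending each vertex of `sd K` to the corresponding
barycenter: `h(x) = ∑ σ, x(σ) b(σ)`. -/
noncomputable def sdMap {V : Type*} (K : AbstractSimplicialComplex V) (x : K.sd.Realization) :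
    K.Realization :=
  have h0 : ∀ v, 0 ≤ (x.coord.sum fun σ a => a • (K.barycenter σ).coord) v := by
    intro v
    rw [Finsupp.sum_apply]
    exact Finset.sum_nonneg fun σ _ => mul_nonneg (x.nonneg σ) ((K.barycenter σ).nonneg v)
  have h1 : ((x.coord.sum fun σ a => a • (K.barycenter σ).coord).sum fun _ a => a) = 1 := by
    have hlin : ∀ z : V →₀ ℝ, (z.sum fun _ a => a) =
        Finsupp.lsum ℝ (fun _ : V => (LinearMap.id : ℝ →ₗ[ℝ] ℝ)) z := fun z => rfl
    rw [hlin, Finsupp.sum, map_sum, ← x.sum_eq_one, Finsupp.sum]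
    refine Finset.sum_congr rfl fun σ _ => ?_
    rw [map_smul, ← hlin, (K.barycenter σ).sum_eq_one, smul_eq_mul, mul_one]
  { coord := x.coord.sum fun σ a => a • (K.barycenter σ).coord
    support_mem := by
      obtain ⟨hne, hch⟩ := x.support_mem
      obtain ⟨m, hm, hmax⟩ := x.coord.support.exists_max_image (fun σ => σ.1.card) hne
      refine (K.isRelLowerSet_faces m.2).2 ?_ ?_
      · intro v hv
        by_contra hvm
        refine Finsupp.mem_support_iff.mp hv ?_
        rw [Finsupp.sum_apply]
        refine Finset.sum_eq_zero fun σ hσ => ?_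
        have hσm : σ.1 ⊆ m.1 := by
          by_cases h : σ = m
          · rw [h]
          · rcases hch hσ hm h with h' | h'
            · exact h'
            · exact (Finset.eq_of_subset_of_card_le h' (hmax σ hσ)).ge
        have : (K.barycenter σ).coord v = 0 :=
          Finsupp.indicator_of_notMem (fun h => hvm (hσm h)) (fun _ _ => (1 / σ.1.card : ℝ))
        simp [this]
      · rw [Finset.nonempty_iff_ne_empty]
        intro h
        rw [Finsupp.sum, h] at h1
        simp at h1
    nonneg := h0
    sum_eq_one := h1 }

end AbstractSimplicialComplex

/-! The inverse of `sdMap` has an explicit formula. If `x` is the image of `y`, then `x v` is the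
sum of `y τ / |τ|` over the chain members `τ` containing `v`, so the coordinates of `x` decrease
along the chain. The coefficient at `σ` is `|σ|` times the drop from the minimum of `x` on `σ` to
its supremum off `σ`, truncated at zero (`sdCoord_sdMap`). This gives injectivity. Each such
coordinate is continuous in the metric, and coordinatewise continuity suffices for maps into a
geometric complex (`continuous_of_coord`), so the inverse is continuous. Surjectivity comes from
peeling off barycenters (`exists_chain_decomposition`).

For the homotopy, a direct straight line from `|g|` to `|f| ∘ h` may leave `|L|`: nothing relates
the `f`-image of a large simplex to the `g`-value of a small face. Hence the vertices of `sd K` are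
switched from `g` to `f` one cardinality at a time. Between adjacent levels, every `f`-vertex in
play comes from a chain member of size at most `m + 1`, every `g`-vertex from one of size at least
`m + 1`. Condition (b) then makes mixed pairs adjacent, and flagness turns pairwise adjacency into a
common simplex (`union_biUnion_support_interpolation_mem`). Finite-dimensionality leaves finitely
many switches. -/

namespace AbstractSimplicialComplex

variable {V W X : Type*}

/-! ### Topology of the geometric complex, linear extensions and straight-line homotopies. -/

namespace Realization

variable {K : AbstractSimplicialComplex V}

/-- Both total masses are `1`, so the mass of `y` off the support of `x` equals its deficit on that
support. Thus finitely many coordinates, fixed by `x` alone, control the whole difference. -/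
lemma l1_sub_le_sum (x y : K.Realization) :
    ((y.coord - x.coord).sum fun _ a => |a|) ≤
      2 * ∑ v ∈ x.coord.support, |y.coord v - x.coord v| := by
  classical
  set S := x.coord.support with hS
  have hsub : (y.coord - x.coord).support ⊆ S ∪ (y.coord.support \ S) := by
    rw [Finset.union_sdiff_self_eq_union, Finset.union_comm]
    exact Finsupp.support_sub
  have hx1 : ∑ v ∈ S, x.coord v = 1 := x.sum_eq_one
  have hy1 : ∑ v ∈ S, y.coord v + ∑ v ∈ y.coord.support \ S, y.coord v = 1 := by
    rw [← Finset.sum_union Finset.disjoint_sdiff, ← y.sum_eq_one,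
      Finsupp.sum_of_support_subset y.coord (s := S ∪ y.coord.support \ S) _ _ (by simp)]
    rw [Finset.union_sdiff_self_eq_union]
    exact Finset.subset_union_right
  have hout : ∑ v ∈ y.coord.support \ S, |y.coord v - x.coord v| =
      ∑ v ∈ y.coord.support \ S, y.coord v := by
    refine Finset.sum_congr rfl fun v hv => ?_
    have : x.coord v = 0 := Finsupp.notMem_support_iff.mp (Finset.mem_sdiff.mp hv).2
    rw [this, sub_zero, abs_of_nonneg (y.nonneg v)]
  have hdiff : ∑ v ∈ S, x.coord v - ∑ v ∈ S, y.coord v ≤ ∑ v ∈ S, |y.coord v - x.coord v| := by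
    rw [← Finset.sum_sub_distrib]
    exact Finset.sum_le_sum fun v _ => by rw [abs_sub_comm]; exact le_abs_self _
  rw [Finsupp.sum_of_support_subset _ hsub _ (by simp), Finset.sum_union Finset.disjoint_sdiff]
  simp only [Finsupp.sub_apply]
  rw [hout]
  linarith

lemma abs_coord_sub_le_dist (x y : K.Realization) (v : V) :
    |x.coord v - y.coord v| ≤ dist x y :=
  abs_le_l2 (x.coord - y.coord) v

lemma continuous_coord (v : V) : Continuous fun x : K.Realization => x.coord v :=
  LipschitzWith.continuous (K := 1) <| LipschitzWith.of_dist_le_mul fun x y => by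
    simpa [Real.dist_eq] using abs_coord_sub_le_dist x y v

/-- The metric topology on `|K|` is the topology of coordinatewise convergence. -/
lemma continuous_of_coord [TopologicalSpace X] {T : X → K.Realization}
    (hT : ∀ v, Continuous fun x => (T x).coord v) : Continuous T := by
  refine continuous_iff_continuousAt.mpr fun x₀ => tendsto_iff_dist_tendsto_zero.mpr ?_
  refine squeeze_zero (fun _ => dist_nonneg)
    (fun x => (l2_le_l1 ((T x).coord - (T x₀).coord)).trans (l1_sub_le_sum (T x₀) (T x))) ?_
  -- The sum runs over the support at the fixed point `x₀`, so it is a finite sum of continuous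
  -- functions vanishing at `x₀`.
  have : Continuous fun x =>
      2 * ∑ v ∈ (T x₀).coord.support, |(T x).coord v - (T x₀).coord v| := by
    refine continuous_const.mul (continuous_finsetSum _ fun v _ => ?_)
    exact ((hT v).sub continuous_const).abs
  simpa using this.tendsto x₀

lemma coord_le_one (x : K.Realization) (v : V) : x.coord v ≤ 1 := by
  by_cases hv : v ∈ x.coord.support
  · rw [← x.sum_eq_one]
    exact Finset.single_le_sum (f := fun v => x.coord v) (fun v _ => x.nonneg v) hv
  · rw [Finsupp.notMem_support_iff.mp hv]
    exact zero_le_one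

lemma support_nonempty (x : K.Realization) : x.coord.support.Nonempty :=
  (K.isRelLowerSet_faces x.support_mem).1

lemma support_mem_of_subset {z : V →₀ ℝ} {s : Finset V} (hs : s ∈ K) (hz : z.support ⊆ s)
    (h1 : (z.sum fun _ a => a) = 1) : z.support ∈ K := by
  refine (K.isRelLowerSet_faces hs).2 hz (Finset.nonempty_iff_ne_empty.mpr fun h => ?_)
  rw [Finsupp.sum, h] at h1
  simp at h1

/-- The vertex `v` of `K` as a point of `|K|`. -/
noncomputable def vertex (K : AbstractSimplicialComplex V) (v : V) : K.Realization where
  coord := Finsupp.single v 1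
  support_mem := by
    rw [Finsupp.support_single v one_ne_zero]
    exact K.singleton_mem v
  nonneg w := by
    classical
    rw [Finsupp.single_apply]
    split_ifs
    exacts [zero_le_one, le_rfl]
  sum_eq_one := by simp

lemma abs_linearCombination_sub_le {c : V → ℝ} (hc : ∀ v, |c v| ≤ 1) (x y : K.Realization) :
    |Finsupp.linearCombination ℝ c y.coord - Finsupp.linearCombination ℝ c x.coord| ≤
      2 * ∑ v ∈ x.coord.support, |y.coord v - x.coord v| := by
  rw [← map_sub, Finsupp.linearCombination_apply]
  refine (Finset.abs_sum_le_sum_abs _ _).trans (le_trans ?_ (l1_sub_le_sum x y))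
  refine Finset.sum_le_sum fun v _ => ?_
  change |_ * c v| ≤ _
  rw [abs_mul]
  exact mul_le_of_le_one_right (abs_nonneg _) (hc v)

/-- Bounded weights are dominated by the `l1` distance, which keeps the functional continuous even
when infinitely many weights are nonzero. -/
lemma continuous_linearCombination {c : V → ℝ} (hc : ∀ v, |c v| ≤ 1) :
    Continuous fun x : K.Realization => Finsupp.linearCombination ℝ c x.coord := by
  refine continuous_iff_continuousAt.mpr fun x₀ => tendsto_iff_dist_tendsto_zero.mpr ?_
  refine squeeze_zero (fun _ => dist_nonneg) (fun x => abs_linearCombination_sub_le hc x₀ x) ?_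
  have : Continuous fun x : K.Realization =>
      2 * ∑ v ∈ x₀.coord.support, |x.coord v - x₀.coord v| := by
    refine continuous_const.mul (continuous_finsetSum _ fun v _ => ?_)
    exact ((continuous_coord v).sub continuous_const).abs
  simpa using this.tendsto x₀

lemma linearCombination_coord_apply {L : AbstractSimplicialComplex W} (p : V → L.Realization)
    (z : V →₀ ℝ) (w : W) :
    Finsupp.linearCombination ℝ (fun v => (p v).coord) z w =
      Finsupp.linearCombination ℝ (fun v => (p v).coord w) z := by
  simp [Finsupp.linearCombination_apply, Finsupp.sum]

/-- The linear extension `|K| → |L|` of a map from the vertices of `K` to points of `|L|` that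
sends the vertices of every simplex into a common simplex. -/
noncomputable def linearExtension [DecidableEq W] {L : AbstractSimplicialComplex W}
    (p : V → L.Realization) (hp : ∀ σ ∈ K, σ.biUnion (fun v => (p v).coord.support) ∈ L) :
    C(K.Realization, L.Realization) where
  toFun x :=
    have h1 : ((Finsupp.linearCombination ℝ (fun v => (p v).coord) x.coord).sum
        fun _ a => a) = 1 := by
      have hlin : ∀ z : W →₀ ℝ, (z.sum fun _ a => a) =
          Finsupp.lsum ℝ (fun _ : W => (LinearMap.id : ℝ →ₗ[ℝ] ℝ)) z := fun z => rfl
      rw [hlin, Finsupp.linearCombination_apply, Finsupp.sum, map_sum, ← x.sum_eq_one, Finsupp.sum]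
      refine Finset.sum_congr rfl fun σ _ => ?_
      rw [map_smul, ← hlin, (p σ).sum_eq_one, smul_eq_mul, mul_one]
    { coord := Finsupp.linearCombination ℝ (fun v => (p v).coord) x.coord
      support_mem := by
        refine support_mem_of_subset (hp _ x.support_mem) ?_ h1
        intro w hw
        rw [Finsupp.mem_support_iff, linearCombination_coord_apply,
          Finsupp.linearCombination_apply] at hw
        obtain ⟨v, hv, hvw⟩ := Finset.exists_ne_zero_of_sum_ne_zero hw
        exact Finset.mem_biUnion.mpr
          ⟨v, hv, Finsupp.mem_support_iff.mpr (right_ne_zero_of_mul hvw)⟩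
      nonneg := by
        intro w
        rw [linearCombination_coord_apply, Finsupp.linearCombination_apply]
        exact Finset.sum_nonneg fun v _ => mul_nonneg (x.nonneg v) ((p v).nonneg w)
      sum_eq_one := h1 }
  continuous_toFun := by
    refine continuous_of_coord fun w => ?_
    simp only [linearCombination_coord_apply]
    refine continuous_linearCombination fun v => ?_
    rw [abs_of_nonneg ((p v).nonneg w)]
    exact (p v).coord_le_one w

lemma linearExtension_coord [DecidableEq W] {L : AbstractSimplicialComplex W}
    (p : V → L.Realization) (hp : ∀ σ ∈ K, σ.biUnion (fun v => (p v).coord.support) ∈ L)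
    (x : K.Realization) : (linearExtension p hp x).coord =
      Finsupp.linearCombination ℝ (fun v => (p v).coord) x.coord := rfl

/-- Two maps to `|K|` are homotopic along straight lines if the values at each point lie in a
common simplex. -/
lemma homotopic_of_union_support_mem [TopologicalSpace X] [DecidableEq V]
    (p q : C(X, K.Realization))
    (h : ∀ x, (p x).coord.support ∪ (q x).coord.support ∈ K) : p.Homotopic q := by
  have h1 (t : unitInterval) (x : X) :
      ((((1 - t : ℝ) • (p x).coord + (t : ℝ) • (q x).coord)).sum fun _ a => a) = 1 := by
    have hlin : ∀ z : V →₀ ℝ, (z.sum fun _ a => a) =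
        Finsupp.lsum ℝ (fun _ : V => (LinearMap.id : ℝ →ₗ[ℝ] ℝ)) z := fun z => rfl
    rw [hlin, map_add, map_smul, map_smul, ← hlin, ← hlin, (p x).sum_eq_one, (q x).sum_eq_one]
    simp
  refine ⟨⟨⟨fun tx => ⟨(1 - tx.1 : ℝ) • (p tx.2).coord + (tx.1 : ℝ) • (q tx.2).coord,
    support_mem_of_subset (h tx.2) ?_ (h1 _ _), ?_, h1 _ _⟩, ?_⟩, ?_, ?_⟩⟩
  · exact Finsupp.support_add.trans
      (Finset.union_subset_union Finsupp.support_smul Finsupp.support_smul)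
  · intro v
    exact add_nonneg (mul_nonneg (sub_nonneg.mpr tx.1.2.2) ((p tx.2).nonneg v))
      (mul_nonneg tx.1.2.1 ((q tx.2).nonneg v))
  · refine continuous_of_coord fun v => ?_
    have hp : Continuous fun x => (p x).coord v := (continuous_coord v).comp p.continuous
    have hq : Continuous fun x => (q x).coord v := (continuous_coord v).comp q.continuous
    have ht : Continuous fun tx : unitInterval × X => (tx.1 : ℝ) :=
      continuous_subtype_val.comp continuous_fst
    exact ((continuous_const.sub ht).mul (hp.comp continuous_snd)).add
      (ht.mul (hq.comp continuous_snd))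
  · intro x
    ext1
    simp
  · intro x
    ext1
    simp

end Realization

/-! ### The homeomorphism between the subdivision and the complex. -/

section Subdivision

open Realization

variable (K : AbstractSimplicialComplex V)

lemma nonempty_of_mem (σ : {σ : Finset V // σ ∈ K}) : σ.1.Nonempty :=
  (K.isRelLowerSet_faces σ.2).1

lemma barycenter_coord_of_mem {σ : {σ : Finset V // σ ∈ K}} {v : V} (hv : v ∈ σ.1) :
    (K.barycenter σ).coord v = 1 / σ.1.card :=
  Finsupp.indicator_of_mem hv (fun _ _ => (1 / σ.1.card : ℝ))

lemma barycenter_coord_of_notMem {σ : {σ : Finset V // σ ∈ K}} {v : V} (hv : v ∉ σ.1) :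
    (K.barycenter σ).coord v = 0 :=
  Finsupp.indicator_of_notMem hv (fun _ _ => (1 / σ.1.card : ℝ))

lemma support_barycenter (σ : {σ : Finset V // σ ∈ K}) :
    (K.barycenter σ).coord.support = σ.1 := by
  have hc : (σ.1.card : ℝ) ≠ 0 := by exact_mod_cast (K.nonempty_of_mem σ).card_ne_zero
  ext v
  rw [Finsupp.mem_support_iff]
  by_cases hv : v ∈ σ.1
  · simp [K.barycenter_coord_of_mem hv, hv, hc]
  · simp [K.barycenter_coord_of_notMem hv, hv]

lemma isChain_support (y : K.sd.Realization) {σ τ : {σ : Finset V // σ ∈ K}}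
    (hσ : σ ∈ y.coord.support) (hτ : τ ∈ y.coord.support) : σ.1 ⊆ τ.1 ∨ τ.1 ⊆ σ.1 := by
  by_cases h : σ = τ
  · exact Or.inl (by rw [h])
  · exact y.support_mem.2 hσ hτ h

lemma sdMap_coord (y : K.sd.Realization) : (K.sdMap y).coord =
    Finsupp.linearCombination ℝ (fun σ => (K.barycenter σ).coord) y.coord := rfl

lemma sdMap_coord_apply [DecidableEq V] (y : K.sd.Realization) (v : V) : (K.sdMap y).coord v =
    ∑ σ ∈ y.coord.support with v ∈ σ.1, y.coord σ / σ.1.card := by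
  rw [sdMap_coord, linearCombination_coord_apply, Finsupp.linearCombination_apply, Finsupp.sum,
    Finset.sum_filter]
  refine Finset.sum_congr rfl fun σ _ => ?_
  split_ifs with hv
  · rw [K.barycenter_coord_of_mem hv, smul_eq_mul, mul_one_div]
  · rw [K.barycenter_coord_of_notMem hv, smul_zero]

lemma continuous_sdMap : Continuous K.sdMap := by
  refine continuous_of_coord fun w => ?_
  simp only [sdMap_coord, linearCombination_coord_apply]
  refine continuous_linearCombination fun σ => ?_
  rw [abs_of_nonneg ((K.barycenter σ).nonneg w)]
  exact (K.barycenter σ).coord_le_one w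

/-- The coordinate at `σ` of the inverse of `sdMap`. -/
noncomputable def sdCoord (σ : {σ : Finset V // σ ∈ K}) (x : K.Realization) : ℝ :=
  σ.1.card * max 0 (σ.1.inf' (K.nonempty_of_mem σ) x.coord - ⨆ v : {v : V // v ∉ σ.1}, x.coord v)

lemma bddAbove_coord (x : K.Realization) (σ : Finset V) :
    BddAbove (Set.range fun v : {v : V // v ∉ σ} => x.coord v) :=
  ⟨1, by rintro _ ⟨v, rfl⟩; exact x.coord_le_one _⟩

/-- The supremum may range over infinitely many vertices, but it is 1-Lipschitz because every
coordinate is. -/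
lemma continuous_sdCoord (σ : {σ : Finset V // σ ∈ K}) : Continuous (K.sdCoord σ) := by
  have hsup (x y : K.Realization) : ⨆ v : {v : V // v ∉ σ.1}, x.coord v ≤
      (⨆ v : {v : V // v ∉ σ.1}, y.coord v) + dist x y := by
    -- The nonnegative bound covers the case where `σ` is the whole vertex set: the supremum over
    -- the empty type is then `0`.
    refine Real.iSup_le (fun v => ?_)
      (add_nonneg (Real.iSup_nonneg fun v => y.nonneg _) dist_nonneg)
    have h₁ := le_ciSup (K.bddAbove_coord y σ.1) v
    have h₂ := (abs_le.mp (abs_coord_sub_le_dist x y v)).2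
    linarith
  have hc : Continuous fun x : K.Realization => ⨆ v : {v : V // v ∉ σ.1}, x.coord v :=
    LipschitzWith.continuous (K := 1) <| LipschitzWith.of_le_add hsup
  refine continuous_const.mul (continuous_const.max (Continuous.sub ?_ hc))
  exact Continuous.finset_inf'_apply _ fun v _ => continuous_coord v

/-- In a chain of finite sets, the members not containing `σ` do not cover `σ`. -/
lemma exists_mem_notMem_of_chain {σ : Finset V} (hσ : σ.Nonempty)
    (s : Finset {σ : Finset V // σ ∈ K})
    (hs : ∀ a ∈ s, ∀ b ∈ s, a.1 ⊆ b.1 ∨ b.1 ⊆ a.1) (hn : ∀ a ∈ s, ¬ σ ⊆ a.1) :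
    ∃ u ∈ σ, ∀ a ∈ s, u ∉ a.1 := by
  rcases s.eq_empty_or_nonempty with rfl | hne
  · exact ⟨hσ.choose, hσ.choose_spec, by simp⟩
  · obtain ⟨m, hm, hmax⟩ := s.exists_max_image (fun a => a.1.card) hne
    obtain ⟨u, hu, hum⟩ := Finset.not_subset.mp (hn m hm)
    refine ⟨u, hu, fun a ha hua => hum ?_⟩
    rcases hs a ha m hm with h | h
    · exact h hua
    · rw [Finset.eq_of_subset_of_card_le h (hmax a ha)]
      exact hua

/-- In a nonempty chain of finite sets strictly containing `σ`, the members have a common element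
outside `σ`. -/
lemma exists_notMem_mem_of_chain {σ : Finset V}
    (s : Finset {σ : Finset V // σ ∈ K}) (hne : s.Nonempty)
    (hs : ∀ a ∈ s, ∀ b ∈ s, a.1 ⊆ b.1 ∨ b.1 ⊆ a.1) (hn : ∀ a ∈ s, σ ⊂ a.1) :
    ∃ u ∉ σ, ∀ a ∈ s, u ∈ a.1 := by
  obtain ⟨m, hm, hmin⟩ := s.exists_min_image (fun a => a.1.card) hne
  obtain ⟨u, hu, huσ⟩ := Finset.exists_of_ssubset (hn m hm)
  refine ⟨u, huσ, fun a ha => ?_⟩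
  rcases hs a ha m hm with h | h
  · rw [Finset.eq_of_subset_of_card_le h (hmin a ha)]
    exact hu
  · exact h hu

lemma sdCoord_sdMap (σ : {σ : Finset V // σ ∈ K}) (y : K.sd.Realization) :
    K.sdCoord σ (K.sdMap y) = y.coord σ := by
  classical
  have hc0 : (σ.1.card : ℝ) ≠ 0 := by exact_mod_cast (K.nonempty_of_mem σ).card_ne_zero
  set S := y.coord.support with hS
  set c : {σ : Finset V // σ ∈ K} → ℝ := fun τ => y.coord τ / τ.1.card with hc
  have hcn (τ) : 0 ≤ c τ := div_nonneg (y.nonneg τ) (Nat.cast_nonneg _)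
  have hch : ∀ a ∈ S, ∀ b ∈ S, a.1 ⊆ b.1 ∨ b.1 ⊆ a.1 := fun a ha b hb => K.isChain_support y ha hb
  have hx (v : V) : (K.sdMap y).coord v = ∑ τ ∈ S with v ∈ τ.1, c τ := K.sdMap_coord_apply y v
  have hsplit : ∑ τ ∈ S with σ.1 ⊆ τ.1, c τ = c σ + ∑ τ ∈ S with σ.1 ⊂ τ.1, c τ := by
    by_cases hσS : σ ∈ S
    · have : S.filter (fun τ => σ.1 ⊆ τ.1) = insert σ (S.filter fun τ => σ.1 ⊂ τ.1) := by
        ext τ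
        simp only [Finset.mem_filter, Finset.mem_insert, Finset.ssubset_iff_subset_ne]
        constructor
        · rintro ⟨h₁, h₂⟩
          by_cases h : τ = σ
          · exact Or.inl h
          · exact Or.inr ⟨h₁, h₂, fun h' => h (Subtype.ext h'.symm)⟩
        · rintro (rfl | ⟨h₁, h₂, -⟩)
          exacts [⟨hσS, subset_rfl⟩, ⟨h₁, h₂⟩]
      rw [this, Finset.sum_insert (by simp)]
    · have h0 : c σ = 0 := by
        simp only [hc]
        rw [Finsupp.notMem_support_iff.mp hσS, zero_div]
      rw [h0, zero_add]
      refine Finset.sum_congr (Finset.filter_congr fun τ hτ => ?_) fun _ _ => rfl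
      rw [Finset.ssubset_iff_subset_ne]
      exact ⟨fun h => ⟨h, fun h' => hσS (by rwa [Subtype.ext h'])⟩, fun h => h.1⟩
  have hinf : σ.1.inf' (K.nonempty_of_mem σ) (K.sdMap y).coord =
      ∑ τ ∈ S with σ.1 ⊆ τ.1, c τ := by
    apply le_antisymm
    -- The minimum is attained at a vertex of `σ` that lies only in those chain members containing
    -- all of `σ`.
    · obtain ⟨u, hu, hun⟩ := K.exists_mem_notMem_of_chain (K.nonempty_of_mem σ)
        (S.filter fun τ => ¬ σ.1 ⊆ τ.1)
        (fun a ha b hb => hch a (Finset.mem_filter.mp ha).1 b (Finset.mem_filter.mp hb).1)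
        (fun a ha => (Finset.mem_filter.mp ha).2)
      refine (Finset.inf'_le _ hu).trans ?_
      rw [hx]
      refine Finset.sum_le_sum_of_subset_of_nonneg (fun τ hτ => ?_) fun _ _ _ => hcn _
      rw [Finset.mem_filter] at hτ ⊢
      refine ⟨hτ.1, ?_⟩
      by_contra h
      exact hun τ (Finset.mem_filter.mpr ⟨hτ.1, h⟩) hτ.2
    · refine Finset.le_inf' _ _ fun v hv => ?_
      rw [hx]
      refine Finset.sum_le_sum_of_subset_of_nonneg (fun τ hτ => ?_) fun _ _ _ => hcn _
      rw [Finset.mem_filter] at hτ ⊢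
      exact ⟨hτ.1, hτ.2 hv⟩
  have hsup : ∑ τ ∈ S with σ.1 ⊂ τ.1, c τ ≤ ⨆ v : {v : V // v ∉ σ.1}, (K.sdMap y).coord v := by
    rcases (S.filter fun τ => σ.1 ⊂ τ.1).eq_empty_or_nonempty with he | hne
    · rw [he, Finset.sum_empty]
      exact Real.iSup_nonneg fun v => (K.sdMap y).nonneg _
    · obtain ⟨u, hu, hum⟩ := K.exists_notMem_mem_of_chain _ hne
        (fun a ha b hb => hch a (Finset.mem_filter.mp ha).1 b (Finset.mem_filter.mp hb).1)
        (fun a ha => (Finset.mem_filter.mp ha).2)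
      refine le_trans ?_ (le_ciSup (K.bddAbove_coord (K.sdMap y) σ.1) ⟨u, hu⟩)
      simp only [hx]
      refine Finset.sum_le_sum_of_subset_of_nonneg (fun τ hτ => ?_) fun _ _ _ => hcn _
      exact Finset.mem_filter.mpr ⟨(Finset.mem_filter.mp hτ).1, hum τ hτ⟩
  -- If `σ` is in the chain, a member meeting the complement of `σ` strictly contains `σ`, so `hsup`
  -- is an equality. Otherwise only the inequality holds; the difference may be negative and the
  -- truncation returns `0`.
  have hmax : max 0 (σ.1.inf' (K.nonempty_of_mem σ) (K.sdMap y).coord -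
      ⨆ v : {v : V // v ∉ σ.1}, (K.sdMap y).coord v) = c σ := by
    rw [hinf, hsplit]
    by_cases hσS : σ ∈ S
    · have hsup' : ⨆ v : {v : V // v ∉ σ.1}, (K.sdMap y).coord v ≤
          ∑ τ ∈ S with σ.1 ⊂ τ.1, c τ := by
        refine Real.iSup_le (fun v => ?_) (Finset.sum_nonneg fun _ _ => hcn _)
        rw [hx]
        refine Finset.sum_le_sum_of_subset_of_nonneg (fun τ hτ => ?_) fun _ _ _ => hcn _
        rw [Finset.mem_filter] at hτ ⊢
        have hnot : ¬ τ.1 ⊆ σ.1 := fun h => v.2 (h hτ.2)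
        exact ⟨hτ.1, ((hch σ hσS τ hτ.1).resolve_right hnot), hnot⟩
      rw [le_antisymm hsup' hsup, add_sub_cancel_right, max_eq_right (hcn σ)]
    · have h0 : c σ = 0 := by
        simp only [hc]
        rw [Finsupp.notMem_support_iff.mp hσS, zero_div]
      rw [h0]
      exact max_eq_left (by linarith)
  rw [sdCoord, hmax]
  exact mul_div_cancel₀ _ hc0

/-- A nonnegative function supported on a simplex is a nonnegative combination of the barycenters
of a chain of faces of its support. -/
lemma exists_chain_decomposition (n : ℕ) : ∀ z : V →₀ ℝ, z.support.card ≤ n →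
    (∀ v, 0 ≤ z v) → (z.support.Nonempty → z.support ∈ K) →
    ∃ y : {σ : Finset V // σ ∈ K} →₀ ℝ, (∀ σ, 0 ≤ y σ) ∧
      (∀ σ ∈ y.support, σ.1 ⊆ z.support) ∧
      (∀ σ ∈ y.support, ∀ τ ∈ y.support, σ.1 ⊆ τ.1 ∨ τ.1 ⊆ σ.1) ∧
      Finsupp.linearCombination ℝ (fun σ => (K.barycenter σ).coord) y = z := by
  classical
  induction n with
  | zero =>
    intro z hz _ _
    have : z = 0 := Finsupp.support_eq_empty.mp (Finset.card_eq_zero.mp (Nat.le_zero.mp hz))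
    exact ⟨0, by simp [this]⟩
  | succ n ih =>
    intro z hz h0 hK
    rcases z.support.eq_empty_or_nonempty with he | hne
    · have : z = 0 := Finsupp.support_eq_empty.mp he
      exact ⟨0, by simp [this]⟩
    obtain ⟨m, hm, hmin⟩ := z.support.exists_min_image z hne
    let σ₀ : {σ : Finset V // σ ∈ K} := ⟨z.support, hK hne⟩
    -- This weight subtracts the minimal value `z m` from every vertex of the support: nothing
    -- becomes negative, and `m` leaves the support. The faces found by induction lie in the smaller
    -- support, so adding `σ₀` on top keeps a chain.
    set a : ℝ := z m * z.support.card with ha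
    have ha0 : 0 ≤ a := mul_nonneg (h0 m) (Nat.cast_nonneg _)
    have hcard : (z.support.card : ℝ) ≠ 0 := by exact_mod_cast hne.card_ne_zero
    set z' := z - a • (K.barycenter σ₀).coord with hz'
    have hin (v : V) (hv : v ∈ z.support) : z' v = z v - z m := by
      rw [hz', Finsupp.sub_apply, Finsupp.smul_apply,
        K.barycenter_coord_of_mem (σ := σ₀) hv, smul_eq_mul, ha]
      change z v - z m * z.support.card * (1 / z.support.card) = _
      field_simp
    have hout (v : V) (hv : v ∉ z.support) : z' v = 0 := by
      rw [hz', Finsupp.sub_apply, Finsupp.smul_apply,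
        K.barycenter_coord_of_notMem (σ := σ₀) hv, Finsupp.notMem_support_iff.mp hv]
      simp
    have hsub : z'.support ⊆ z.support := fun v hv => by
      by_contra h
      exact Finsupp.mem_support_iff.mp hv (hout v h)
    have hm' : m ∉ z'.support := by
      rw [Finsupp.notMem_support_iff, hin m hm, sub_self]
    have hss : z'.support ⊂ z.support :=
      ⟨hsub, fun h => hm' (h hm)⟩
    obtain ⟨y, hy0, hysub, hych, hy⟩ := ih z'
      (Nat.lt_succ_iff.mp ((Finset.card_lt_card hss).trans_le hz))
      (fun v => by
        by_cases hv : v ∈ z.support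
        · rw [hin v hv]
          exact sub_nonneg.mpr (hmin v hv)
        · rw [hout v hv])
      (fun h => (K.isRelLowerSet_faces (hK hne)).2 hsub h)
    have hmem (σ) (hσ : σ ∈ (y + Finsupp.single σ₀ a).support) : σ ∈ y.support ∨ σ = σ₀ := by
      rcases Finset.mem_union.mp (Finsupp.support_add hσ) with h | h
      · exact Or.inl h
      · exact Or.inr (Finset.mem_singleton.mp (Finsupp.support_single_subset h))
    refine ⟨y + Finsupp.single σ₀ a, fun σ => ?_, fun σ hσ => ?_, fun σ hσ τ hτ => ?_, ?_⟩
    · rw [Finsupp.add_apply, Finsupp.single_apply]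
      refine add_nonneg (hy0 σ) ?_
      split_ifs
      exacts [ha0, le_rfl]
    · rcases hmem σ hσ with h | rfl
      exacts [(hysub σ h).trans hsub, subset_rfl]
    · rcases hmem σ hσ with h | rfl <;> rcases hmem τ hτ with h' | rfl
      · exact hych σ h τ h'
      · exact Or.inl ((hysub σ h).trans hsub)
      · exact Or.inr ((hysub τ h').trans hsub)
      · exact Or.inl subset_rfl
    · rw [map_add, hy, Finsupp.linearCombination_single, hz', sub_add_cancel]

lemma sdMap_injective : Function.Injective K.sdMap := fun y y' h =>
  Realization.ext <| Finsupp.ext fun σ => by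
    rw [← K.sdCoord_sdMap σ y, h, K.sdCoord_sdMap]

lemma sdMap_surjective : Function.Surjective K.sdMap := by
  intro x
  obtain ⟨y, hy0, -, hych, hy⟩ := K.exists_chain_decomposition _ x.coord le_rfl x.nonneg
    fun _ => x.support_mem
  have h1 : (y.sum fun _ a => a) = 1 := by
    have hlin : ∀ z : V →₀ ℝ, (z.sum fun _ a => a) =
        Finsupp.lsum ℝ (fun _ : V => (LinearMap.id : ℝ →ₗ[ℝ] ℝ)) z := fun z => rfl
    rw [← x.sum_eq_one, ← hy, hlin, Finsupp.linearCombination_apply, Finsupp.sum, Finsupp.sum,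
      map_sum]
    refine Finset.sum_congr rfl fun σ _ => ?_
    rw [map_smul, ← hlin, (K.barycenter σ).sum_eq_one, smul_eq_mul, mul_one]
  refine ⟨⟨y, ⟨Finset.nonempty_iff_ne_empty.mpr fun h => ?_,
    fun σ hσ τ hτ _ => hych σ hσ τ hτ⟩, hy0, h1⟩, Realization.ext hy⟩
  rw [Finsupp.sum, h] at h1
  simp at h1

/-- The homeomorphism `|sd K| ≃ |K|`. -/
noncomputable def sdHomeomorph : K.sd.Realization ≃ₜ K.Realization where
  toEquiv := Equiv.ofBijective K.sdMap ⟨K.sdMap_injective, K.sdMap_surjective⟩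
  continuous_toFun := K.continuous_sdMap
  continuous_invFun := by
    refine continuous_of_coord fun σ => (K.continuous_sdCoord σ).congr fun x => ?_
    obtain ⟨y, rfl⟩ := K.sdMap_surjective x
    rw [K.sdCoord_sdMap]
    exact congrArg (fun y : K.sd.Realization => y.coord σ)
      (Equiv.ofBijective_symm_apply_apply K.sdMap
        ⟨K.sdMap_injective, K.sdMap_surjective⟩ y).symm

end Subdivision

/-! ### The homotopy, by switching from `g` to `f` one cardinality at a time. -/

section Homotopy

open Realization

variable [DecidableEq W] {K : AbstractSimplicialComplex V} {L : AbstractSimplicialComplex W}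

lemma IsFlag.mem_of_pairwise (hL : L.IsFlag) {s : Finset W} (hs : s.Nonempty)
    (h : ∀ u ∈ s, ∀ v ∈ s, ∃ t ∈ L, u ∈ t ∧ v ∈ t) : s ∈ L := by
  refine hL s hs fun u hu v hv _ => ?_
  obtain ⟨t, ht, hut, hvt⟩ := h u hu v hv
  exact (L.isRelLowerSet_faces ht).2 (by simp [Finset.insert_subset_iff, hut, hvt])
    (Finset.insert_nonempty _ _)

variable (f : SimplicialMap K L) (g : SimplicialMap K.sd L)

/-- The map on the vertices of `sd K` that agrees with `f` on the barycenters of the simplices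
with at most `m` vertices, and with `g` on the others. -/
noncomputable def interpolation (m : ℕ) (σ : {σ : Finset V // σ ∈ K}) : L.Realization :=
  if σ.1.card ≤ m then f.realization (K.barycenter σ) else vertex L (g.toFun σ)

lemma mem_support_interpolation {m : ℕ} {σ : {σ : Finset V // σ ∈ K}} {w : W}
    (hw : w ∈ (interpolation f g m σ).coord.support) :
    (σ.1.card ≤ m ∧ w ∈ σ.1.image f.toFun) ∨ (m < σ.1.card ∧ w = g.toFun σ) := by
  classical
  rw [interpolation] at hw
  split_ifs at hw with h
  · refine Or.inl ⟨h, ?_⟩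
    have := Finsupp.mapDomain_support (f := f.toFun) (s := (K.barycenter σ).coord) hw
    rwa [support_barycenter] at this
  · exact Or.inr ⟨not_le.mp h, Finset.mem_singleton.mp (Finsupp.support_single_subset hw)⟩

variable {f g}

/-- Interpolations of adjacent levels take a simplex of `sd K` into a common simplex of `L`. -/
lemma union_biUnion_support_interpolation_mem (hL : L.IsFlag)
    (hb : ∀ (σ : Finset V) (hσ : σ ∈ K), σ.image f.toFun ∪ {g.toFun ⟨σ, hσ⟩} ∈ L) (m : ℕ)
    {s : Finset {σ : Finset V // σ ∈ K}} (hs : s ∈ K.sd) :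
    s.biUnion (fun σ => (interpolation f g m σ).coord.support) ∪
      s.biUnion (fun σ => (interpolation f g (m + 1) σ).coord.support) ∈ L := by
  have hch {σ τ : {σ : Finset V // σ ∈ K}} (hσ : σ ∈ s) (hτ : τ ∈ s) :
      σ.1 ⊆ τ.1 ∨ τ.1 ⊆ σ.1 := by
    by_cases h : σ = τ
    · exact Or.inl (by rw [h])
    · exact hs.2 hσ hτ h
  have hmem {w : W} (hw : w ∈ s.biUnion (fun σ => (interpolation f g m σ).coord.support) ∪
      s.biUnion (fun σ => (interpolation f g (m + 1) σ).coord.support)) :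
      ∃ σ ∈ s, (σ.1.card ≤ m + 1 ∧ w ∈ σ.1.image f.toFun) ∨
        (m + 1 ≤ σ.1.card ∧ w = g.toFun σ) := by
    rcases Finset.mem_union.mp hw with hw | hw <;>
      obtain ⟨σ, hσ, hw⟩ := Finset.mem_biUnion.mp hw <;>
      rcases mem_support_interpolation f g hw with ⟨h, h'⟩ | ⟨h, h'⟩
    · exact ⟨σ, hσ, Or.inl ⟨by omega, h'⟩⟩
    · exact ⟨σ, hσ, Or.inr ⟨by omega, h'⟩⟩
    · exact ⟨σ, hσ, Or.inl ⟨by omega, h'⟩⟩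
    · exact ⟨σ, hσ, Or.inr ⟨by omega, h'⟩⟩
  -- In a chain the size bounds force `σ ⊆ τ`, with equality if both sizes are `m + 1`; so `u` lies
  -- in the simplex that (b) provides for `τ`.
  have hmixed {σ τ : {σ : Finset V // σ ∈ K}} (hσ : σ ∈ s) (hτ : τ ∈ s) {u : W}
      (hσm : σ.1.card ≤ m + 1) (hτm : m + 1 ≤ τ.1.card) (hu : u ∈ σ.1.image f.toFun) :
      u ∈ τ.1.image f.toFun ∪ {g.toFun τ} := by
    refine Finset.mem_union_left _ (Finset.image_subset_image ?_ hu)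
    rcases hch hσ hτ with h | h
    · exact h
    · exact (Finset.eq_of_subset_of_card_le h (hσm.trans hτm)).ge
  refine hL.mem_of_pairwise ?_ fun u hu v hv => ?_
  · obtain ⟨σ, hσ⟩ := hs.1
    obtain ⟨w, hw⟩ := (interpolation f g m σ).support_nonempty
    exact ⟨w, Finset.mem_union_left _ (Finset.mem_biUnion.mpr ⟨σ, hσ, hw⟩)⟩
  obtain ⟨σ, hσ, ⟨hσm, hu⟩ | ⟨hσm, rfl⟩⟩ := hmem hu <;>
    obtain ⟨τ, hτ, ⟨hτm, hv⟩ | ⟨hτm, rfl⟩⟩ := hmem hv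
  · rcases hch hσ hτ with h | h
    · exact ⟨_, f.image_mem _ τ.2, Finset.image_subset_image h hu, hv⟩
    · exact ⟨_, f.image_mem _ σ.2, hu, Finset.image_subset_image h hv⟩
  · exact ⟨_, hb τ.1 τ.2, hmixed hσ hτ hσm hτm hu, by simp⟩
  · exact ⟨_, hb σ.1 σ.2, by simp, hmixed hτ hσ hτm hσm hv⟩
  · exact ⟨_, g.image_mem s hs, Finset.mem_image_of_mem _ hσ, Finset.mem_image_of_mem _ hτ⟩

lemma biUnion_support_interpolation_mem (hL : L.IsFlag)
    (hb : ∀ (σ : Finset V) (hσ : σ ∈ K), σ.image f.toFun ∪ {g.toFun ⟨σ, hσ⟩} ∈ L) (m : ℕ)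
    (s : Finset {σ : Finset V // σ ∈ K}) (hs : s ∈ K.sd) :
    s.biUnion (fun σ => (interpolation f g m σ).coord.support) ∈ L := by
  refine (L.isRelLowerSet_faces (union_biUnion_support_interpolation_mem hL hb m hs)).2
    Finset.subset_union_left ?_
  obtain ⟨σ, hσ⟩ := hs.1
  obtain ⟨w, hw⟩ := (interpolation f g m σ).support_nonempty
  exact ⟨w, Finset.mem_biUnion.mpr ⟨σ, hσ, hw⟩⟩

lemma support_linearExtension_subset (p : V → L.Realization)
    (hp : ∀ σ ∈ K, σ.biUnion (fun v => (p v).coord.support) ∈ L) (x : K.Realization) :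
    (linearExtension p hp x).coord.support ⊆
      x.coord.support.biUnion fun v => (p v).coord.support := by
  intro w hw
  rw [linearExtension_coord, Finsupp.mem_support_iff, linearCombination_coord_apply,
    Finsupp.linearCombination_apply] at hw
  obtain ⟨v, hv, hvw⟩ := Finset.exists_ne_zero_of_sum_ne_zero hw
  exact Finset.mem_biUnion.mpr ⟨v, hv, Finsupp.mem_support_iff.mpr (right_ne_zero_of_mul hvw)⟩

lemma linearExtension_interpolation_homotopic (hL : L.IsFlag)
    (hb : ∀ (σ : Finset V) (hσ : σ ∈ K), σ.image f.toFun ∪ {g.toFun ⟨σ, hσ⟩} ∈ L) (m : ℕ) :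
    (linearExtension (interpolation f g 0)
        (biUnion_support_interpolation_mem hL hb 0)).Homotopic
      (linearExtension (interpolation f g m) (biUnion_support_interpolation_mem hL hb m)) := by
  induction m with
  | zero => exact ContinuousMap.Homotopic.refl _
  | succ m ih =>
    refine ih.trans (homotopic_of_union_support_mem _ _ fun x => ?_)
    refine (L.isRelLowerSet_faces
      (union_biUnion_support_interpolation_mem hL hb m x.support_mem)).2
      (Finset.union_subset_union (support_linearExtension_subset _ _ _)
        (support_linearExtension_subset _ _ _)) ?_
    exact (support_nonempty _).mono Finset.subset_union_left

lemma linearExtension_interpolation_zero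
    (hp : ∀ s ∈ K.sd, s.biUnion (fun σ => (interpolation f g 0 σ).coord.support) ∈ L) :
    linearExtension (interpolation f g 0) hp = g.realization := by
  ext1 x
  refine Realization.ext ?_
  change Finsupp.linearCombination ℝ _ _ = Finsupp.mapDomain g.toFun x.coord
  rw [Finsupp.linearCombination_apply, Finsupp.mapDomain]
  refine Finset.sum_congr rfl fun σ _ => ?_
  have : ¬ σ.1.card ≤ 0 := by simpa using (K.nonempty_of_mem σ).ne_empty
  simp [interpolation, this, vertex]

lemma linearExtension_interpolation_of_card_le {n : ℕ} (hn : ∀ σ ∈ K, σ.card ≤ n)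
    (hp : ∀ s ∈ K.sd, s.biUnion (fun σ => (interpolation f g n σ).coord.support) ∈ L) :
    linearExtension (interpolation f g n) hp =
      f.realization.comp (K.sdHomeomorph : C(K.sd.Realization, K.Realization)) := by
  ext1 x
  refine Realization.ext ?_
  change Finsupp.linearCombination ℝ _ _ = Finsupp.lmapDomain ℝ ℝ f.toFun
    (Finsupp.linearCombination ℝ (fun σ => (K.barycenter σ).coord) x.coord)
  rw [Finsupp.linearCombination_apply, Finsupp.linearCombination_apply, Finsupp.sum, Finsupp.sum,
    map_sum]
  refine Finset.sum_congr rfl fun σ _ => ?_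
  rw [map_smul, interpolation, if_pos (hn σ.1 σ.2)]
  rfl

end Homotopy

end AbstractSimplicialComplex

theorem proposition2 {V W : Type*} [DecidableEq W]
    (K : AbstractSimplicialComplex V) (L : AbstractSimplicialComplex W)
    (hK : K.IsFiniteDimensional) (hL : L.IsFlag)
    (f : AbstractSimplicialComplex.SimplicialMap K L)
    (g : AbstractSimplicialComplex.SimplicialMap K.sd L)
    (ha : ∀ v : V, g.toFun ⟨{v}, K.singleton_mem v⟩ = f.toFun v)
    (hb : ∀ (σ : Finset V) (hσ : σ ∈ K), σ.image f.toFun ∪ {g.toFun ⟨σ, hσ⟩} ∈ L) :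
    ∃ h : K.sd.Realization ≃ₜ K.Realization,
      (∀ x, h x = K.sdMap x) ∧
      g.realization.Homotopic (f.realization.comp (h : C(K.sd.Realization, K.Realization))) ∧
      (g.realization.comp (h.symm : C(K.Realization, K.sd.Realization))).Homotopic
        f.realization := by
  obtain ⟨k, hk⟩ := hK
  have hgf : g.realization.Homotopic
      (f.realization.comp (K.sdHomeomorph : C(K.sd.Realization, K.Realization))) := by
    -- Simplices have at most `k + 1` vertices, so at level `k + 1` every barycenter has been
    -- switched to `f`.
    have h := AbstractSimplicialComplex.linearExtension_interpolation_homotopic hL hb (k + 1)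
    rwa [AbstractSimplicialComplex.linearExtension_interpolation_zero,
      AbstractSimplicialComplex.linearExtension_interpolation_of_card_le hk] at h
  refine ⟨K.sdHomeomorph, fun _ => rfl, hgf, ?_⟩
  have h := hgf.comp (ContinuousMap.Homotopic.refl
    (K.sdHomeomorph.symm : C(K.Realization, K.sd.Realization)))
  have hid : (K.sdHomeomorph : C(K.sd.Realization, K.Realization)).comp
      (K.sdHomeomorph.symm : C(K.Realization, K.sd.Realization)) = ContinuousMap.id _ := by
    ext1 x
    exact K.sdHomeomorph.apply_symm_apply x
  rwa [ContinuousMap.comp_assoc, hid, ContinuousMap.comp_id] at h
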